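/- For $p\in\mathbb{N}$ let $\Delta^p=\{z\in\mathbb{R}^p : z_1\ge\cdots\ge z_p\}$, let $z_{[i]}$ be the $i$-th largest component of $z\in\mathbb{R}^p$, and for $z,w\in\mathbb{R}^p$ write $z\ge_m w$ ($z$ majorizes $w$) if $\sum_{i=1}^{j} z_{[i]}\ge\sum_{i=1}^{j} w_{[i]}$ for $j=1,\dots,p-1$ and $\sum_{i=1}^{p} z_{[i]}=\sum_{i=1}^{p} w_{[i]}$. Let $n,m\ge 1$ be integers, let $H=[a,b]^n\times[c,d]^m$ with $a\ge 0$ and $c\ge 0$, let $\alpha>0$, $\beta>0$ be real, and let $$S=\Bigl\{(x,y)\in H : \prod_{i=1}^m y_i^{\alpha}\ \ge\ \prod_{j=1}^n x_j^{\beta}\Bigr\},\qquad k=\min\{m,\lfloor \beta/\alpha\rfloor\}.$$ For $i=0,\dots,m-k$ and $j=0,\dots,n-1$ let $S_{ij}$ be the set of all $(x,y)\in S$ with $y\in\Delta^m$ such that $y_r=d$ for $1\le r\le i$, $y_r=c$ for $i+k+1\le r\le m$, $x_s=b$ for $1\le s\le j$, and $x_s=a$ for $j+2\le s\le n$. For $j=0,\dots,n$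 let $C_j$ be the set of all $(x,y)\in S$ with $y\in\Delta^m$ such that $x_s=b$ for $1\le s\le j$ and $x_s=a$ for $j+1\le s\le n$. Let $T=\bigcup_{i,j}S_{ij}\cup\bigcup_j C_j$. Then all the sets $S_{ij}$ and $C_j$ are convex, and $$\mathrm{conv}(S)=\bigl\{(x,y)\in\mathbb{R}^n\times\mathbb{R}^m : \text{there is } (u,v)\in\mathrm{conv}(T) \text{ with } u\ge_m x \text{ and } v\ge_m y\bigr\}.$$ In particular, if $m\alpha\le\beta$, then $$\mathrm{conv}(S)=\Bigl\{(x,y)\in H : \prod_{i=1}^m y_i^{1/m}\ \ge\ \prod_{j=1}^n \bigl(u(x)_j\bigr)^{\beta/(m\alpha)}\Bigr\},$$ where $u(x)=u^{s}$ with $s=\sum_{i=1}^n (x_i-a)$, and for $0\le s\le n(b-a)$ the vector $u^s\in\mathbb{R}^n$ is defined, with $i^s=\max\{i\in\mathbb{Z} : i(b-a)<s\}$, by $u^s_i=b$ if $i\le i^s$, $u^s_i=a+s-(b-a)i^s$ if $i=i^s+1$, and $u^s_i=a$ otherwise (in the degenerate case $a=b$, where $s=0$, put $i^s=0$, so that all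 components of $u^s$ are equal to $a$). -/

import Mathlib

namespace PermHull

noncomputable section

/-- The components of `x` in non-increasing order: `sortedDesc x i` is the `(i+1)`-st largest
component of `x`. -/
def sortedDesc {n : ℕ} (x : Fin n → ℝ) : Fin n → ℝ :=
  fun i => x (Tuple.sort (fun l => -x l) i)

/-- `Majorizes x y`: the vector `x` majorizes `y`. For every `1 ≤ j ≤ n - 1` the sum of the `j`
largest components of `x` is at least that of `y`, and the total sums are equal. -/
def Majorizes {n : ℕ} (x y : Fin n → ℝ) : Prop :=
  (∀ j : ℕ, 1 ≤ j → j < n →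
    ∑ i : Fin n with i.val < j, sortedDesc y i ≤ ∑ i : Fin n with i.val < j, sortedDesc x i) ∧
  ∑ i, sortedDesc x i = ∑ i, sortedDesc y i

/-- The cone of vectors with `x₁ ≥ x₂ ≥ ⋯ ≥ xₙ`. -/
def descCone (n : ℕ) : Set (Fin n → ℝ) := {x | Antitone x}

/-- The box `[a,b]ⁿ × [c,d]ᵐ`. -/
def box (n m : ℕ) (a b c d : ℝ) : Set ((Fin n → ℝ) × (Fin m → ℝ)) :=
  {p | (∀ j, p.1 j ∈ Set.Icc a b) ∧ (∀ i, p.2 i ∈ Set.Icc c d)}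

/-- The set of all `(x, y)` in the box with `∏ yᵢ ^ α ≥ ∏ xⱼ ^ β`. -/
def monoSet (n m : ℕ) (a b c d α β : ℝ) : Set ((Fin n → ℝ) × (Fin m → ℝ)) :=
  {p | p ∈ box n m a b c d ∧ ∏ j, p.1 j ^ β ≤ ∏ i, p.2 i ^ α}

/-- `k = min {m, ⌊β / α⌋}`. -/
def freeCount (m : ℕ) (α β : ℝ) : ℕ := min m ⌊β / α⌋₊

/-- The piece `S_{ij}`: the first `i` of the `y`'s are `d`, the next `k` are free, the others
are `c`, and `y` is non-increasing; the first `j` of the `x`'s are `b`, the next one is free,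
the others are `a`. (Indices in `Fin` start at `0`.) -/
def pieceS (n m : ℕ) (a b c d α β : ℝ) (i j : ℕ) : Set ((Fin n → ℝ) × (Fin m → ℝ)) :=
  monoSet n m a b c d α β ∩
    {p | p ∈ box n m a b c d ∧
      (∀ r : Fin m, r.val < i → p.2 r = d) ∧
      (∀ r : Fin m, i + freeCount m α β ≤ r.val → p.2 r = c) ∧
      p.2 ∈ descCone m ∧
      (∀ s : Fin n, s.val < j → p.1 s = b) ∧
      (∀ s : Fin n, j + 1 ≤ s.val → p.1 s = a)}

/-- The piece `C_j`: the first `j` of the `x`'s are `b`, the others are `a`, and `y` is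
non-increasing. -/
def pieceC (n m : ℕ) (a b c d α β : ℝ) (j : ℕ) : Set ((Fin n → ℝ) × (Fin m → ℝ)) :=
  monoSet n m a b c d α β ∩
    {p | p ∈ box n m a b c d ∧
      (∀ s : Fin n, s.val < j → p.1 s = b) ∧
      (∀ s : Fin n, j ≤ s.val → p.1 s = a) ∧
      p.2 ∈ descCone m}

/-- The union `T` of all `S_{ij}` with `0 ≤ i ≤ m - k`, `0 ≤ j ≤ n - 1` and all `C_j` with
`0 ≤ j ≤ n`. -/
def pieceUnion (n m : ℕ) (a b c d α β : ℝ) : Set ((Fin n → ℝ) × (Fin m → ℝ)) :=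
  (⋃ i ∈ Set.Iic (m - freeCount m α β), ⋃ j ∈ Set.Iio n, pieceS n m a b c d α β i j) ∪
    ⋃ j ∈ Set.Iic n, pieceC n m a b c d α β j

/-- The lifted description: all `(x, y)` for which there is `(u, v) ∈ conv T` such that `u`
majorizes `x` and `v` majorizes `y`. -/
def liftedHull (n m : ℕ) (a b c d α β : ℝ) : Set ((Fin n → ℝ) × (Fin m → ℝ)) :=
  {p | ∃ (u : Fin n → ℝ) (v : Fin m → ℝ), Majorizes v p.2 ∧ Majorizes u p.1 ∧
    (u, v) ∈ convexHull ℝ (pieceUnion n m a b c d α β)}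

/-- The integer `iˢ = max {i ∈ ℤ | i (b - a) < s}`. The maximum exists if `a < b`; for `a = b`
(where only `s = 0` occurs) the set is empty and the value is `0`. -/
def stepIndex (a b s : ℝ) : ℤ := sSup {i : ℤ | (i : ℝ) * (b - a) < s}

/-- The vector `uˢ`: its `i`-th component is `b` for `i ≤ iˢ`, it is `a + s - (b - a) iˢ` for
`i = iˢ + 1`, and `a` otherwise. The `i`-th component has index `i - 1` in `Fin n`. -/
def stepVec (n : ℕ) (a b s : ℝ) : Fin n → ℝ := fun r =>
  if (r.val : ℤ) + 1 ≤ stepIndex a b s then b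
  else if (r.val : ℤ) + 1 = stepIndex a b s + 1 then a + s - (b - a) * stepIndex a b s
  else a

/-- `u(x) = u^{S(x)}` with `S(x) = ∑ (xᵢ - a)`. -/
def majVec {n : ℕ} (a b : ℝ) (x : Fin n → ℝ) : Fin n → ℝ :=
  stepVec n a b (∑ i, (x i - a))

/-- The description without lifting: all `(x, y)` in the box with
`∏ yᵢ ^ (1/m) ≥ ∏ u(x)ⱼ ^ (β/(mα))`. -/
def unliftedHull (n m : ℕ) (a b c d α β : ℝ) : Set ((Fin n → ℝ) × (Fin m → ℝ)) :=
  {p | p ∈ box n m a b c d ∧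
    ∏ j, majVec a b p.1 j ^ (β / ((m : ℝ) * α)) ≤ ∏ i, p.2 i ^ (1 / (m : ℝ))}

end

end PermHull

namespace PermHull

/-! ### Power products and geometric means -/

/-! The condition defining S reads `∏ x ≤ (∏ y) ^ (α / β)`. By weighted AM-GM, `(∏ i ∈ F, y i) ^ e`
is concave on the nonnegative orthant when `|F| * e ≤ 1` (`concaveOn_prod_rpow`). On a piece S_ij at
most k of the y's and one x vary, so an affine function is bounded by a concave one. On C_j the
vector x is fixed, and the geometric mean of all y's serves instead.

Every convex, permutation invariant set K containing T contains S
(`monoSet_subset_of_pieceUnion_subset`), by induction on the number of components strictly between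
their bounds. Two such x's can be spread apart, which lowers their product. One such x together with
more than k such y's can be scaled along a line that Bernoulli's inequality keeps in S, in both
directions, until a bound is hit. Otherwise the sorted point lies in T. The lifted set is such a K:
T consists of sorted vectors, and for these majorization is preserved by convex combinations.
Conversely, Rado's theorem (`Majorizes.mem_convexHull`) puts the lifted set inside conv(S).

For `m * α ≤ β` the right side is concave in all of y. The product of `u^s` is the maximum of
finitely many affine functions of s, and it is a lower bound for `∏ x` when s is the sum of the `x i
- a` (`affine_le_prod`). Hence the unlifted set is convex and contains S; it lies in conv(S) because
`u(x)` majorizes x. -/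

theorem prod_rpow_le_prod_rpow_iff {ι κ : Type*} [Fintype ι] [Fintype κ] {x : ι → ℝ} {y : κ → ℝ}
    (hx : ∀ i, 0 ≤ x i) (hy : ∀ i, 0 ≤ y i) {p : ℝ} (hp : 0 < p) (q : ℝ) :
    ∏ i, x i ^ p ≤ ∏ i, y i ^ q ↔ ∏ i, x i ≤ (∏ i, y i) ^ (q / p) := by
  have hX : 0 ≤ ∏ i, x i := Finset.prod_nonneg fun i _ => hx i
  have hY : 0 ≤ ∏ i, y i := Finset.prod_nonneg fun i _ => hy i
  rw [Real.finsetProd_rpow _ _ fun i _ => hx i, Real.finsetProd_rpow _ _ fun i _ => hy i,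
    div_eq_mul_inv, Real.rpow_mul hY, Real.le_rpow_inv_iff_of_pos hX (Real.rpow_nonneg hY _) hp]

/-- AM-GM with weight `e` on each `z i` and the leftover weight `1 - s.card * e` on an extra entry
1, indexed by `none`. -/
theorem prod_rpow_le_sum_add {ι : Type*} (s : Finset ι) {e : ℝ} (he : 0 ≤ e)
    (hs : (s.card : ℝ) * e ≤ 1) {z : ι → ℝ} (hz : ∀ i ∈ s, 0 ≤ z i) :
    (∏ i ∈ s, z i) ^ e ≤ ∑ i ∈ s, e * z i + (1 - s.card * e) := by
  have h := Real.geom_mean_le_arith_mean_weighted (Finset.insertNone s)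
    (fun o => o.elim (1 - s.card * e) fun _ => e) (fun o => o.elim 1 z)
    (by rintro (_ | i) _ <;> simp <;> linarith) (by simp)
    (by rintro (_ | i) hi <;> simp_all)
  simp only [Finset.prod_insertNone, Finset.sum_insertNone, Option.elim, Real.one_rpow,
    one_mul, mul_one] at h
  rw [Real.finsetProd_rpow _ _ hz] at h
  linarith

/-- AM-GM applied to the ratios `v i / w i` gives a supporting hyperplane at the intermediate point
`w`; averaging it over `v = y` and `v = z` gives concavity. If some factor of `w` vanishes, it
vanishes at both endpoints, because the weights are positive. -/
theorem concaveOn_prod_rpow {ι : Type*} (s : Finset ι) {e : ℝ} (he : 0 < e)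
    (hs : (s.card : ℝ) * e ≤ 1) :
    ConcaveOn ℝ {y : ι → ℝ | ∀ i, 0 ≤ y i} (fun y => (∏ i ∈ s, y i) ^ e) := by
  have hconv : Convex ℝ {y : ι → ℝ | ∀ i, 0 ≤ y i} := by
    intro y hy z hz l r hl hr _ i
    have h1 := mul_nonneg hl (hy i)
    have h2 := mul_nonneg hr (hz i)
    simpa using add_nonneg h1 h2
  refine concaveOn_iff_forall_pos.2 ⟨hconv, ?_⟩
  intro y hy z hz l r hl hr hlr
  have hw : ∀ i, 0 ≤ (l • y + r • z) i := hconv hy hz hl.le hr.le hlr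
  set w := l • y + r • z with hwdef
  have hwi : ∀ i, w i = l * y i + r * z i := fun i => by simp [hwdef]
  simp only [smul_eq_mul]
  by_cases h0 : ∀ i ∈ s, w i ≠ 0
  · have hpos : ∀ i ∈ s, 0 < w i := fun i hi => lt_of_le_of_ne (hw i) (h0 i hi).symm
    have key : ∀ v : ι → ℝ, (∀ i, 0 ≤ v i) → (∏ i ∈ s, v i) ^ e ≤
        (∏ i ∈ s, w i) ^ e * (∑ i ∈ s, e * (v i / w i) + (1 - s.card * e)) := by
      intro v hv
      have h := prod_rpow_le_sum_add s he.le hs (z := fun i => v i / w i)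
        (fun i hi => div_nonneg (hv i) (hw i))
      have h2 : ∏ i ∈ s, v i = (∏ i ∈ s, w i) * ∏ i ∈ s, v i / w i := by
        rw [← Finset.prod_mul_distrib]
        exact Finset.prod_congr rfl fun i hi => (mul_div_cancel₀ _ (h0 i hi)).symm
      rw [h2, Real.mul_rpow (Finset.prod_nonneg fun i _ => hw i)
        (Finset.prod_nonneg fun i _ => div_nonneg (hv i) (hw i))]
      exact mul_le_mul_of_nonneg_left h
        (Real.rpow_nonneg (Finset.prod_nonneg fun i _ => hw i) _)
    have h1 := mul_le_mul_of_nonneg_left (key y hy) hl.le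
    have h2 := mul_le_mul_of_nonneg_left (key z hz) hr.le
    refine (add_le_add h1 h2).trans (le_of_eq ?_)
    have h3 : l * (∑ i ∈ s, e * (y i / w i)) + r * (∑ i ∈ s, e * (z i / w i)) = s.card * e := by
      rw [Finset.mul_sum, Finset.mul_sum, ← Finset.sum_add_distrib, ← nsmul_eq_mul,
        ← Finset.sum_const]
      refine Finset.sum_congr rfl fun i hi => ?_
      have := h0 i hi
      field_simp
      rw [hwi i]
    linear_combination (∏ i ∈ s, w i) ^ e * h3 +
      (∏ i ∈ s, w i) ^ e * (1 - s.card * e) * hlr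
  · push Not at h0
    obtain ⟨i, hi, hi0⟩ := h0
    rw [hwi i] at hi0
    have h1 := mul_nonneg hl.le (hy i)
    have h2 := mul_nonneg hr.le (hz i)
    have hy0 : y i = 0 := by
      rcases mul_eq_zero.1 (by linarith : l * y i = 0) with h | h
      · exact absurd h hl.ne'
      · exact h
    have hz0 : z i = 0 := by
      rcases mul_eq_zero.1 (by linarith : r * z i = 0) with h | h
      · exact absurd h hr.ne'
      · exact h
    rw [Finset.prod_eq_zero hi hy0, Finset.prod_eq_zero hi hz0, Real.zero_rpow he.ne']
    simpa using Real.rpow_nonneg (Finset.prod_nonneg fun i _ => hw i) e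

/-! ### Convexity of the pieces -/

theorem convex_box (n m : ℕ) (a b c d : ℝ) : Convex ℝ (box n m a b c d) := by
  intro p hp q hq l r hl hr hlr
  exact ⟨fun j => convex_Icc a b (hp.1 j) (hq.1 j) hl hr hlr,
    fun i => convex_Icc c d (hp.2 i) (hq.2 i) hl hr hlr⟩

variable {n m : ℕ} {a b c d α β : ℝ}

theorem mem_monoSet_iff (ha : 0 ≤ a) (hc : 0 ≤ c) (hβ : 0 < β)
    {p : (Fin n → ℝ) × (Fin m → ℝ)} : p ∈ monoSet n m a b c d α β ↔
      p ∈ box n m a b c d ∧ ∏ j, p.1 j ≤ (∏ i, p.2 i) ^ (α / β) := by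
  refine and_congr_right fun hp => ?_
  exact prod_rpow_le_prod_rpow_iff (fun j => ha.trans (hp.1 j).1) (fun i => hc.trans (hp.2 i).1)
    hβ α

/-- Segments in the monomial set whose endpoints differ in at most one `x` and in so few of the
`y`'s that the geometric mean is concave. -/
theorem segment_mem_monoSet (ha : 0 ≤ a) (hc : 0 ≤ c) (hα : 0 < α) (hβ : 0 < β)
    {p q : (Fin n → ℝ) × (Fin m → ℝ)} (hp : p ∈ monoSet n m a b c d α β)
    (hq : q ∈ monoSet n m a b c d α β) (F : Finset (Fin m)) (hF : (F.card : ℝ) * α ≤ β)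
    (hpqF : ∀ i ∉ F, p.2 i = q.2 i) (j : Fin n) (hpqj : ∀ i ≠ j, p.1 i = q.1 i)
    {l r : ℝ} (hl : 0 ≤ l) (hr : 0 ≤ r) (hlr : l + r = 1) :
    l • p + r • q ∈ monoSet n m a b c d α β := by
  rw [mem_monoSet_iff ha hc hβ] at *
  refine ⟨convex_box n m a b c d hp.1 hq.1 hl hr hlr, ?_⟩
  have he : 0 < α / β := div_pos hα hβ
  have hcon := (concaveOn_prod_rpow F he (by rw [← mul_div_assoc]; exact (div_le_one hβ).2 hF)).2
    (x := p.2) (fun i => hc.trans (hp.1.2 i).1) (y := q.2) (fun i => hc.trans (hq.1.2 i).1)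
    hl hr hlr
  have hself : ∀ t : ℝ, l * t + r * t = t := fun t => by rw [← add_mul, hlr, one_mul]
  -- The y's outside `F` agree at both endpoints, so they contribute one common nonnegative factor.
  have hsplit : ∀ v : Fin m → ℝ, (∀ i, 0 ≤ v i) → (∀ i ∉ F, v i = p.2 i) →
      (∏ i, v i) ^ (α / β) = (∏ i ∈ F, v i) ^ (α / β) * (∏ i ∈ Fᶜ, p.2 i) ^ (α / β) := by
    intro v hv hvF
    rw [← Real.mul_rpow (Finset.prod_nonneg fun i _ => hv i)
      (Finset.prod_nonneg fun i _ => hc.trans (hp.1.2 i).1), ← Finset.prod_mul_prod_compl F v]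
    congr 2
    exact Finset.prod_congr rfl fun i hi => hvF i (Finset.mem_compl.1 hi)
  have hbox := convex_box n m a b c d hp.1 hq.1 hl hr hlr
  have hD : 0 ≤ (∏ i ∈ Fᶜ, p.2 i) ^ (α / β) :=
    Real.rpow_nonneg (Finset.prod_nonneg fun i _ => hc.trans (hp.1.2 i).1) _
  have h1 := hp.2
  have h2 := hq.2
  rw [hsplit _ (fun i => hc.trans (hp.1.2 i).1) fun _ _ => rfl] at h1
  rw [hsplit _ (fun i => hc.trans (hq.1.2 i).1) fun i hi => (hpqF i hi).symm] at h2
  rw [hsplit _ (fun i => hc.trans (hbox.2 i).1) fun i hi => by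
    simp [← hpqF i hi, hself]]
  -- Only the factor with index `j` varies, so the product is affine along the segment.
  have hX : ∏ i, (l • p + r • q).1 i = l * ∏ i, p.1 i + r * ∏ i, q.1 i := by
    have e1 : ∏ i ∈ Finset.univ.erase j, (l • p + r • q).1 i = ∏ i ∈ Finset.univ.erase j, p.1 i :=
      Finset.prod_congr rfl fun i hi => by simp [← hpqj i (Finset.ne_of_mem_erase hi), hself]
    have e2 : ∏ i ∈ Finset.univ.erase j, q.1 i = ∏ i ∈ Finset.univ.erase j, p.1 i :=
      Finset.prod_congr rfl fun i hi => (hpqj i (Finset.ne_of_mem_erase hi)).symm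
    rw [← Finset.mul_prod_erase _ _ (Finset.mem_univ j),
      ← Finset.mul_prod_erase _ p.1 (Finset.mem_univ j),
      ← Finset.mul_prod_erase _ q.1 (Finset.mem_univ j), e1, e2]
    simp only [Prod.fst_add, Prod.smul_fst, Pi.add_apply, Pi.smul_apply, smul_eq_mul]
    ring
  rw [hX]
  calc l * ∏ i, p.1 i + r * ∏ i, q.1 i
      ≤ l * ((∏ i ∈ F, p.2 i) ^ (α / β) * (∏ i ∈ Fᶜ, p.2 i) ^ (α / β)) +
        r * ((∏ i ∈ F, q.2 i) ^ (α / β) * (∏ i ∈ Fᶜ, p.2 i) ^ (α / β)) := by gcongr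
    _ = (l • (∏ i ∈ F, p.2 i) ^ (α / β) + r • (∏ i ∈ F, q.2 i) ^ (α / β)) *
        (∏ i ∈ Fᶜ, p.2 i) ^ (α / β) := by simp only [smul_eq_mul]; ring
    _ ≤ _ := mul_le_mul_of_nonneg_right hcon hD

theorem convex_descCone (n : ℕ) : Convex ℝ (descCone n) := by
  intro p hp q hq l r hl hr _ i j hij
  have h1 := mul_le_mul_of_nonneg_left (hp hij) hl
  have h2 := mul_le_mul_of_nonneg_left (hq hij) hr
  simpa using add_le_add h1 h2

theorem freeCount_mul_le (hα : 0 < α) (hβ : 0 < β) : (freeCount m α β : ℝ) * α ≤ β := by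
  have h1 : (freeCount m α β : ℝ) ≤ β / α :=
    (Nat.cast_le.2 (min_le_right _ _)).trans (Nat.floor_le (div_nonneg hβ.le hα.le))
  exact (le_div_iff₀ hα).1 h1

theorem convex_pieceS (ha : 0 ≤ a) (hc : 0 ≤ c) (hα : 0 < α) (hβ : 0 < β) {i j : ℕ}
    (hj : j < n) : Convex ℝ (pieceS n m a b c d α β i j) := by
  rintro p ⟨hpS, hpb, hpd, hpc, hpm, hp1, hp2⟩ q ⟨hqS, hqb, hqd, hqc, hqm, hq1, hq2⟩ l r hl hr hlr
  have hself : ∀ t : ℝ, l * t + r * t = t := fun t => by rw [← add_mul, hlr, one_mul]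
  refine ⟨?_, convex_box n m a b c d hpb hqb hl hr hlr, ?_, ?_,
    convex_descCone m hpm hqm hl hr hlr, ?_, ?_⟩
  · refine segment_mem_monoSet ha hc hα hβ hpS hqS
      {s : Fin m | i ≤ s.val ∧ s.val < i + freeCount m α β} ?_ ?_ ⟨j, hj⟩ ?_ hl hr hlr
    · refine (mul_le_mul_of_nonneg_right (Nat.cast_le.2 ?_) hα.le).trans
        (freeCount_mul_le (m := m) hα hβ)
      calc _ = (Finset.image Fin.val
            {s : Fin m | i ≤ s.val ∧ s.val < i + freeCount m α β}).card :=
            (Finset.card_image_of_injective _ Fin.val_injective).symm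
        _ ≤ (Finset.Ico i (i + freeCount m α β)).card := Finset.card_le_card (by
            intro s hs
            simp only [Finset.mem_image, Finset.mem_filter] at hs
            obtain ⟨s, hs, rfl⟩ := hs
            exact Finset.mem_Ico.2 hs.2)
        _ = _ := by simp
    · intro s hs
      simp only [Finset.mem_filter, Finset.mem_univ, true_and, not_and, not_lt] at hs
      rcases lt_or_ge s.val i with h | h
      · rw [hpd s h, hqd s h]
      · rw [hpc s (hs h), hqc s (hs h)]
    · intro s hs
      rcases lt_or_ge s.val j with h | h
      · rw [hp1 s h, hq1 s h]
      · have h' : j + 1 ≤ s.val := lt_of_le_of_ne h fun h' => hs (Fin.ext h'.symm)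
        rw [hp2 s h', hq2 s h']
  all_goals
    intro s hs
    simp_all

theorem convex_pieceC (ha : 0 ≤ a) (hc : 0 ≤ c) (hα : 0 < α)
    (hm : 1 ≤ m) (j : ℕ) : Convex ℝ (pieceC n m a b c d α β j) := by
  rintro p ⟨hpS, hpb, hp1, hp2, hpm⟩ q ⟨hqS, hqb, hq1, hq2, hqm⟩ l r hl hr hlr
  have hself : ∀ t : ℝ, l * t + r * t = t := fun t => by rw [← add_mul, hlr, one_mul]
  have hpq : q.1 = p.1 := by
    ext s
    rcases lt_or_ge s.val j with h | h
    · rw [hp1 s h, hq1 s h]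
    · rw [hp2 s h, hq2 s h]
  have hx : (l • p + r • q).1 = p.1 := by
    ext s
    simp [hpq, hself]
  have hbox := convex_box n m a b c d hpb hqb hl hr hlr
  refine ⟨⟨hbox, ?_⟩, hbox, hx ▸ hp1, hx ▸ hp2, convex_descCone m hpm hqm hl hr hlr⟩
  have hm0 : (0 : ℝ) < m := by exact_mod_cast hm
  have hcon := (concaveOn_prod_rpow (Finset.univ : Finset (Fin m)) (e := 1 / m)
    (by positivity) (by simp [hm0.ne'])).2
    (x := p.2) (fun i => hc.trans (hpb.2 i).1) (y := q.2) (fun i => hc.trans (hqb.2 i).1)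
    hl hr hlr
  -- As x is constant on the piece, both sides may be raised to the power `1 / (m * α)`; the y side
  -- becomes a geometric mean, concave for every ratio of `α` and `β`.
  have hY : ∀ y : Fin m → ℝ, (∀ i, y i ∈ Set.Icc c d) → (∏ j, p.1 j ^ β ≤ ∏ i, y i ^ α ↔
      (∏ j, p.1 j) ^ (β / (m * α)) ≤ (∏ i, y i) ^ (1 / (m : ℝ))) := by
    intro y hy
    have hX0 : 0 ≤ ∏ j, p.1 j := Finset.prod_nonneg fun i _ => ha.trans (hpb.1 i).1
    have hY0 : 0 ≤ ∏ j, y j := Finset.prod_nonneg fun i _ => hc.trans (hy i).1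
    rw [Real.finsetProd_rpow _ _ fun i _ => ha.trans (hpb.1 i).1,
      Real.finsetProd_rpow _ _ fun i _ => hc.trans (hy i).1,
      ← Real.rpow_le_rpow_iff (Real.rpow_nonneg hX0 _) (Real.rpow_nonneg hY0 _)
        (by positivity : 0 < 1 / (m * α)), ← Real.rpow_mul hX0, ← Real.rpow_mul hY0]
    congr! 2
    · ring
    · field_simp
  have h1 := (hY _ hpb.2).1 hpS.2
  have h2 := (hY q.2 hqb.2).1 (hpq ▸ hqS.2)
  rw [hx, hY _ hbox.2]
  refine le_trans ?_ hcon
  rw [← hself ((∏ j, p.1 j) ^ (β / (m * α)))]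
  simp only [smul_eq_mul]
  gcongr

/-! ### Majorization -/

theorem antitone_sortedDesc {n : ℕ} (x : Fin n → ℝ) : Antitone (sortedDesc x) := fun _ _ hij =>
  neg_le_neg_iff.1 (Tuple.monotone_sort (fun l => -x l) hij)

theorem sortedDesc_comp {n : ℕ} (x : Fin n → ℝ) (σ : Equiv.Perm (Fin n)) :
    sortedDesc (x ∘ σ) = sortedDesc x := by
  ext i
  have h := congrFun (Tuple.comp_perm_comp_sort_eq_comp_sort (f := fun l => -x l) (σ := σ)) i
  exact neg_injective h

theorem sortedDesc_of_antitone {n : ℕ} {x : Fin n → ℝ} (hx : Antitone x) : sortedDesc x = x := by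
  have h : Tuple.sort (fun l => -x l) = Equiv.refl _ :=
    Tuple.sort_eq_refl_iff_monotone.2 fun i j hij => neg_le_neg (hx hij)
  ext i
  simp [sortedDesc, h]

theorem exists_sortedDesc_eq_comp {n : ℕ} (x : Fin n → ℝ) :
    ∃ σ : Equiv.Perm (Fin n), sortedDesc x = x ∘ σ :=
  ⟨_, rfl⟩

theorem sum_sortedDesc {n : ℕ} (x : Fin n → ℝ) : ∑ i, sortedDesc x i = ∑ i, x i :=
  Equiv.sum_comp (Tuple.sort fun l => -x l) x

/-- The sum of any `j` components is at most the sum of the `j` largest ones. -/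
theorem sum_comp_le_sum_sortedDesc {n : ℕ} (x : Fin n → ℝ) (σ : Equiv.Perm (Fin n)) (j : ℕ) :
    ∑ i : Fin n with i.val < j, x (σ i) ≤ ∑ i : Fin n with i.val < j, sortedDesc x i := by
  obtain ⟨τ, hτ⟩ := exists_sortedDesc_eq_comp x
  have hg : Antitone fun i : Fin n => if i.val < j then (1 : ℝ) else 0 := by
    intro i k hik
    have : i.val ≤ k.val := hik
    dsimp only
    split_ifs <;> first | omega | norm_num
  have h := Monovary.sum_comp_perm_mul_le_sum_mul (σ := σ.trans τ.symm)
    ((antitone_sortedDesc x).monovary hg)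
  simpa [Finset.sum_filter, hτ] using h

/-- The permutation sorting the combination is only one competitor for the largest `j`-term sums of
`x` and of `y`. -/
theorem sortedDesc_prefix_convex {n : ℕ} (x y : Fin n → ℝ) {l r : ℝ} (hl : 0 ≤ l) (hr : 0 ≤ r)
    (j : ℕ) : ∑ i : Fin n with i.val < j, sortedDesc (l • x + r • y) i ≤
      l * ∑ i : Fin n with i.val < j, sortedDesc x i +
      r * ∑ i : Fin n with i.val < j, sortedDesc y i := by
  obtain ⟨σ, hσ⟩ := exists_sortedDesc_eq_comp (l • x + r • y)
  have h1 := mul_le_mul_of_nonneg_left (sum_comp_le_sum_sortedDesc x σ j) hl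
  have h2 := mul_le_mul_of_nonneg_left (sum_comp_le_sum_sortedDesc y σ j) hr
  refine le_trans (le_of_eq ?_) (add_le_add h1 h2)
  rw [hσ, Finset.mul_sum, Finset.mul_sum, ← Finset.sum_add_distrib]
  simp

theorem majorizes_comp_right {n : ℕ} {u x : Fin n → ℝ} (σ : Equiv.Perm (Fin n)) :
    Majorizes u (x ∘ σ) ↔ Majorizes u x := by
  simp [Majorizes, sortedDesc_comp]

theorem Majorizes.refl {n : ℕ} (u : Fin n → ℝ) : Majorizes u u := ⟨fun _ _ _ => le_rfl, rfl⟩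

/-- For non-increasing `u` and `v` the prefix sums on the majorizing side are linear, while those on
the majorized side are convex. This is why the pieces consist of sorted vectors. -/
theorem Majorizes.convex_comb {n : ℕ} {u v x y : Fin n → ℝ} (hu : Antitone u) (hv : Antitone v)
    (hux : Majorizes u x) (hvy : Majorizes v y) {l r : ℝ} (hl : 0 ≤ l) (hr : 0 ≤ r)
    (hlr : l + r = 1) : Majorizes (l • u + r • v) (l • x + r • y) := by
  have h : Antitone (l • u + r • v) := convex_descCone n hu hv hl hr hlr
  constructor
  · intro j h1 h2
    refine (sortedDesc_prefix_convex x y hl hr j).trans ?_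
    have e1 := mul_le_mul_of_nonneg_left (hux.1 j h1 h2) hl
    have e2 := mul_le_mul_of_nonneg_left (hvy.1 j h1 h2) hr
    refine (add_le_add e1 e2).trans (le_of_eq ?_)
    rw [sortedDesc_of_antitone h, sortedDesc_of_antitone hu, sortedDesc_of_antitone hv,
      Finset.mul_sum, Finset.mul_sum, ← Finset.sum_add_distrib]
    simp
  · have e1 := hux.2
    have e2 := hvy.2
    simp only [sum_sortedDesc] at *
    simp [Finset.sum_add_distrib, ← Finset.mul_sum, e1, e2]

/-- Abel summation in inductive form: lowering the last weight from `W n` to `W (n + 1)` costs a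
multiple of a nonnegative prefix sum. -/
theorem last_mul_sum_le_sum_mul (W D : ℕ → ℝ) (n : ℕ) (hW : ∀ i < n, W (i + 1) ≤ W i)
    (hD : ∀ j ≤ n, 0 ≤ ∑ i ∈ Finset.range j, D i) :
    W n * ∑ i ∈ Finset.range (n + 1), D i ≤ ∑ i ∈ Finset.range (n + 1), W i * D i := by
  induction n with
  | zero => simp
  | succ n ih =>
    have h1 := ih (fun i hi => hW i (by omega)) fun j hj => hD j (by omega)
    have h2 := mul_le_mul_of_nonneg_right (hW n (by omega)) (hD (n + 1) le_rfl)
    rw [Finset.sum_range_succ D, Finset.sum_range_succ (fun i => W i * D i)]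
    linarith

theorem sum_mul_le_sum_mul_of_prefix {n : ℕ} {W U V : Fin n → ℝ} (hW : Antitone W)
    (h : ∀ j, j < n → ∑ i : Fin n with i.val < j, V i ≤ ∑ i : Fin n with i.val < j, U i)
    (htot : ∑ i, V i = ∑ i, U i) : ∑ i, W i * V i ≤ ∑ i, W i * U i := by
  cases n with
  | zero => simp
  | succ n =>
    let W' : ℕ → ℝ := fun i => W ⟨min i n, by omega⟩
    let D : ℕ → ℝ := fun i => if hi : i < n + 1 then U ⟨i, hi⟩ - V ⟨i, hi⟩ else 0
    have hD : ∀ i : Fin (n + 1), D i = U i - V i := fun i => dif_pos i.isLt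
    have hW' : ∀ i : Fin (n + 1), W' i = W i := fun i => by
      simp only [W']
      congr 1
      ext
      simpa using Nat.lt_succ_iff.1 i.isLt
    have key := last_mul_sum_le_sum_mul W' D n
      (fun i _ => hW (Fin.mk_le_mk.2 (by omega))) (by
        intro j hj
        have e : ∑ i ∈ Finset.range j, D i = ∑ i : Fin (n + 1) with i.val < j, (U i - V i) := by
          rw [Finset.sum_filter,
            Finset.sum_congr rfl (g := fun i : Fin (n + 1) => (fun k : ℕ => if k < j then D k else 0) i)
              (fun i _ => by simp [hD]),
            Fin.sum_univ_eq_sum_range (fun k : ℕ => if k < j then D k else 0),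
            ← Finset.sum_filter]
          congr 1
          ext k
          simp only [Finset.mem_range, Finset.mem_filter]
          omega
        rw [e, Finset.sum_sub_distrib]
        linarith [h j (by omega)])
    rw [← Fin.sum_univ_eq_sum_range, ← Fin.sum_univ_eq_sum_range (fun i => W' i * D i)] at key
    simp only [hD, hW', Finset.sum_sub_distrib, mul_sub, htot] at key
    linarith

/-- Rado's theorem: a vector lies in the convex hull of the rearrangements of any vector that
majorizes it. -/
theorem Majorizes.mem_convexHull {n : ℕ} {u x : Fin n → ℝ} (h : Majorizes u x) :
    x ∈ convexHull ℝ (Set.range fun σ : Equiv.Perm (Fin n) => u ∘ σ) := by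
  by_contra hx
  -- Separate `x` from the hull. Rearranging `u` in the same order as the coefficients of `f` gives
  -- a value at least `f x`, by Abel summation, which contradicts the separation.
  obtain ⟨f, t, hf, hft⟩ := geometric_hahn_banach_closed_point (convex_convexHull ℝ _)
    ((Set.finite_range _).isClosed_convexHull ℝ) hx
  let w : Fin n → ℝ := fun i => f fun j => if i = j then 1 else 0
  have hfw : ∀ z, f z = ∑ i, w i * z i := fun z => by
    have := LinearMap.pi_apply_eq_sum_univ (f : (Fin n → ℝ) →ₗ[ℝ] ℝ) z
    simpa [w, mul_comm] using this
  obtain ⟨τ, hτ⟩ := exists_sortedDesc_eq_comp w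
  obtain ⟨ρ, hρ⟩ := exists_sortedDesc_eq_comp u
  have h1 := hf (u ∘ (τ.symm.trans ρ)) (subset_convexHull ℝ _ ⟨τ.symm.trans ρ, rfl⟩)
  have h2 : ∑ i, sortedDesc w i * x (τ i) ≤ ∑ i, sortedDesc w i * sortedDesc u i := by
    refine sum_mul_le_sum_mul_of_prefix (antitone_sortedDesc w) ?_ ?_
    · intro j hj
      rcases Nat.eq_zero_or_pos j with rfl | hj0
      · simp
      · exact (sum_comp_le_sum_sortedDesc x τ j).trans (h.1 j hj0 hj)
    · rw [Equiv.sum_comp τ x, ← sum_sortedDesc x, h.2]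
  have h3 : f x = ∑ i, sortedDesc w i * x (τ i) := by
    rw [hfw, hτ, ← Equiv.sum_comp τ]
    rfl
  have h4 : f (u ∘ (τ.symm.trans ρ)) = ∑ i, sortedDesc w i * sortedDesc u i := by
    rw [hfw, hτ, hρ, ← Equiv.sum_comp τ]
    simp
  linarith

/-! ### Permutation invariant convex sets -/

/-- Invariance under rearranging either of the two vectors. -/
def PermInvariant {n m : ℕ} (K : Set ((Fin n → ℝ) × (Fin m → ℝ))) : Prop :=
  ∀ p ∈ K, ∀ (σ : Equiv.Perm (Fin n)) (τ : Equiv.Perm (Fin m)), (p.1 ∘ σ, p.2 ∘ τ) ∈ K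

theorem PermInvariant.convexHull {K : Set ((Fin n → ℝ) × (Fin m → ℝ))} (hK : PermInvariant K) :
    PermInvariant (convexHull ℝ K) := by
  intro p hp σ τ
  let f : ((Fin n → ℝ) × (Fin m → ℝ)) →ₗ[ℝ] ((Fin n → ℝ) × (Fin m → ℝ)) :=
    (LinearMap.funLeft ℝ ℝ σ).prodMap (LinearMap.funLeft ℝ ℝ τ)
  have h : _root_.convexHull ℝ K ⊆ f ⁻¹' _root_.convexHull ℝ K :=
    convexHull_min (fun q hq => subset_convexHull ℝ _ (hK q hq σ τ))
      ((convex_convexHull ℝ K).linear_preimage f)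
  exact h hp

/-- Rado's theorem is applied twice to slices of `K`: first in the x direction for each
rearrangement of `v`, then in the y direction. -/
theorem PermInvariant.mem_of_majorizes {K : Set ((Fin n → ℝ) × (Fin m → ℝ))}
    (hK : PermInvariant K) (hconv : Convex ℝ K) {u x : Fin n → ℝ} {v y : Fin m → ℝ}
    (huv : (u, v) ∈ K) (hu : Majorizes u x) (hv : Majorizes v y) : (x, y) ∈ K := by
  have h1 : ∀ τ : Equiv.Perm (Fin m), (x, v ∘ τ) ∈ K := by
    intro τ
    have hc : Convex ℝ {z : Fin n → ℝ | (z, v ∘ τ) ∈ K} := by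
      intro z hz w hw l r hl hr hlr
      have := hconv hz hw hl hr hlr
      simpa [← add_smul, hlr] using this
    refine convexHull_min ?_ hc hu.mem_convexHull
    rintro _ ⟨σ, rfl⟩
    exact hK _ huv σ τ
  have hc : Convex ℝ {z : Fin m → ℝ | (x, z) ∈ K} := by
    intro z hz w hw l r hl hr hlr
    have := hconv hz hw hl hr hlr
    simpa [← add_smul, hlr] using this
  refine convexHull_min ?_ hc hv.mem_convexHull
  rintro _ ⟨τ, rfl⟩
  exact h1 τ

theorem permInvariant_monoSet : PermInvariant (monoSet n m a b c d α β) := by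
  rintro p ⟨hb, hp⟩ σ τ
  refine ⟨⟨fun j => hb.1 _, fun i => hb.2 _⟩, ?_⟩
  have h1 := Equiv.prod_comp σ fun i => p.1 i ^ β
  have h2 := Equiv.prod_comp τ fun i => p.2 i ^ α
  simpa [h1, h2] using hp

theorem permInvariant_liftedHull : PermInvariant (liftedHull n m a b c d α β) := by
  rintro p ⟨u, v, hv, hu, h⟩ σ τ
  exact ⟨u, v, (majorizes_comp_right τ).2 hv, (majorizes_comp_right σ).2 hu, h⟩

theorem pieceUnion_subset_monoSet :
    pieceUnion n m a b c d α β ⊆ monoSet n m a b c d α β := by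
  rintro p (hp | hp) <;> simp only [Set.mem_iUnion] at hp
  · obtain ⟨i, _, j, _, h⟩ := hp
    exact h.1
  · obtain ⟨j, _, h⟩ := hp
    exact h.1

theorem pieceUnion_subset_descCone :
    pieceUnion n m a b c d α β ⊆ descCone n ×ˢ descCone m := by
  rintro p (hp | hp) <;> simp only [Set.mem_iUnion] at hp
  · obtain ⟨i, _, j, _, -, hb, -, -, hm, h1, h2⟩ := hp
    refine ⟨fun r s hrs => ?_, hm⟩
    have hrs' : r.val ≤ s.val := hrs
    rcases lt_or_ge r.val j with h | h
    · rw [h1 r h]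
      exact (hb.1 s).2
    · rcases eq_or_lt_of_le hrs' with h' | h'
      · rw [Fin.ext h']
      · rw [h2 s (by omega)]
        exact (hb.1 r).1
  · obtain ⟨j, _, -, hb, h1, h2, hm⟩ := hp
    refine ⟨fun r s hrs => ?_, hm⟩
    have hrs' : r.val ≤ s.val := hrs
    rcases lt_or_ge r.val j with h | h
    · rw [h1 r h]
      exact (hb.1 s).2
    · rw [h2 s (by omega)]
      exact (hb.1 r).1

theorem convexHull_pieceUnion_subset_descCone :
    convexHull ℝ (pieceUnion n m a b c d α β) ⊆ descCone n ×ˢ descCone m :=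
  convexHull_min pieceUnion_subset_descCone ((convex_descCone n).prod (convex_descCone m))

theorem convex_liftedHull : Convex ℝ (liftedHull n m a b c d α β) := by
  rintro p ⟨u, v, hv, hu, h⟩ q ⟨u', v', hv', hu', h'⟩ l r hl hr hlr
  obtain ⟨du, dv⟩ := convexHull_pieceUnion_subset_descCone h
  obtain ⟨du', dv'⟩ := convexHull_pieceUnion_subset_descCone h'
  exact ⟨l • u + r • u', l • v + r • v', hv.convex_comb dv dv' hv' hl hr hlr,
    hu.convex_comb du du' hu' hl hr hlr, convex_convexHull ℝ _ h h' hl hr hlr⟩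

theorem liftedHull_subset_convexHull :
    liftedHull n m a b c d α β ⊆ convexHull ℝ (monoSet n m a b c d α β) := by
  rintro p ⟨u, v, hv, hu, h⟩
  exact permInvariant_monoSet.convexHull.mem_of_majorizes (convex_convexHull ℝ _)
    (convexHull_mono pieceUnion_subset_monoSet h) hu hv

theorem pieceUnion_subset_liftedHull :
    pieceUnion n m a b c d α β ⊆ liftedHull n m a b c d α β := fun p hp =>
  ⟨p.1, p.2, .refl _, .refl _, subset_convexHull ℝ _ hp⟩

/-! ### Reduction of points of the monomial set to the pieces -/

/-- The indices of the components strictly between the bounds. -/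
noncomputable def interiorSet (a b : ℝ) (x : Fin n → ℝ) : Finset (Fin n) := {i | a < x i ∧ x i < b}

theorem mem_interiorSet {x : Fin n → ℝ} {i : Fin n} :
    i ∈ interiorSet a b x ↔ a < x i ∧ x i < b := by simp [interiorSet]

theorem card_interiorSet_comp (x : Fin n → ℝ) (σ : Equiv.Perm (Fin n)) :
    (interiorSet a b (x ∘ σ)).card = (interiorSet a b x).card := by
  refine Finset.card_bij (fun i _ => σ i) (fun i hi => ?_) (fun i _ j _ h => σ.injective h)
    fun i hi => ⟨σ.symm i, ?_, σ.apply_symm_apply i⟩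
  · simpa [mem_interiorSet] using hi
  · simpa [mem_interiorSet] using hi

theorem lt_card_filter_iff (P : Fin n → Prop) [DecidablePred P]
    (hP : ∀ i j, i ≤ j → P j → P i) (r : Fin n) :
    r.val < (Finset.univ.filter P).card ↔ P r := by
  constructor
  · intro hr
    by_contra h
    have : (Finset.univ.filter P) ⊆ Finset.Iio r := by
      intro i hi
      refine Finset.mem_Iio.2 (lt_of_not_ge fun hri => h (hP r i hri ?_))
      exact (Finset.mem_filter.1 hi).2
    have := Finset.card_le_card this
    rw [Fin.card_Iio] at this
    omega
  · intro hr
    have : Finset.Iic r ⊆ Finset.univ.filter P := fun i hi =>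
      Finset.mem_filter.2 ⟨Finset.mem_univ _, hP i r (Finset.mem_Iic.1 hi) hr⟩
    have := Finset.card_le_card this
    rw [Fin.card_Iic] at this
    omega

theorem exists_shape_of_antitone {z : Fin n → ℝ} (hz : Antitone z) (hab : ∀ i, z i ∈ Set.Icc a b) :
    ∃ j, j + (interiorSet a b z).card ≤ n ∧ (∀ r : Fin n, r.val < j → z r = b) ∧
      ∀ r : Fin n, j + (interiorSet a b z).card ≤ r.val → z r = a := by
  refine ⟨(Finset.univ.filter fun i => z i = b).card, ?_, fun r hr => ?_, fun r hr => ?_⟩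
  · rw [← Finset.card_union_of_disjoint]
    · simpa using Finset.card_le_univ (α := Fin n) _
    · refine Finset.disjoint_left.2 fun i hi hi' => ?_
      exact (mem_interiorSet.1 hi').2.ne (Finset.mem_filter.1 hi).2
  · exact (lt_card_filter_iff (fun i => z i = b)
      (fun i j hij hj => le_antisymm (hab i).2 (hj ▸ hz hij)) r).1 hr
  · have h := lt_card_filter_iff (fun i => a < z i ∨ z i = b) (fun i j hij hj =>
      hj.imp (fun h => h.trans_le (hz hij)) fun h => le_antisymm (hab i).2 (h.symm.le.trans (hz hij))) r
    have hle : (Finset.univ.filter fun i => a < z i ∨ z i = b).card ≤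
        (Finset.univ.filter fun i => z i = b).card + (interiorSet a b z).card := by
      refine (Finset.card_le_card fun i hi => ?_).trans (Finset.card_union_le _ _)
      have hi' := (Finset.mem_filter.1 hi).2
      rw [Finset.mem_union, mem_interiorSet, Finset.mem_filter]
      by_cases hb : z i = b
      · exact Or.inl ⟨Finset.mem_univ _, hb⟩
      · exact Or.inr ⟨hi'.resolve_right hb, lt_of_le_of_ne (hab i).2 hb⟩
    have h' : ¬ (a < z r ∨ z r = b) := fun hc => by
      have := h.2 hc
      omega
    exact le_antisymm (not_lt.1 fun hc => h' (Or.inl hc)) (hab r).1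

theorem mem_pieceUnion_of_antitone {p : (Fin n → ℝ) × (Fin m → ℝ)}
    (hp : p ∈ monoSet n m a b c d α β) (h1 : Antitone p.1) (h2 : Antitone p.2)
    (hN : (interiorSet a b p.1).card = 0 ∨ ((interiorSet a b p.1).card = 1 ∧
      (interiorSet c d p.2).card ≤ freeCount m α β)) : p ∈ pieceUnion n m a b c d α β := by
  obtain ⟨j, hjn, hjb, hja⟩ := exists_shape_of_antitone h1 hp.1.1
  rcases hN with hN | ⟨hN, hM⟩
  · refine Or.inr ?_
    rw [hN, add_zero] at hjn hja
    simp only [Set.mem_iUnion]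
    exact ⟨j, hjn, hp, hp.1, hjb, hja, h2⟩
  · refine Or.inl ?_
    rw [hN] at hjn hja
    obtain ⟨i, him, hid, hic⟩ := exists_shape_of_antitone h2 hp.1.2
    simp only [Set.mem_iUnion]
    have hk : freeCount m α β ≤ m := min_le_left _ _
    -- The free window must have exactly k places within `m`. If it would overrun, it starts earlier
    -- and takes in components equal to `d`.
    refine ⟨min i (m - freeCount m α β), min_le_right i _, j, hjn, hp, hp.1,
      fun r hr => hid r (lt_of_lt_of_le hr (min_le_left _ _)), fun r hr => hic r ?_, h2, hjb, hja⟩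
    have := r.isLt
    omega

/-- Moving along a line inside a product of intervals until a first bound is reached. -/
theorem exists_first_exit {ι : Type*} (s : Finset ι) (hs : s.Nonempty) (lo hi w v : ι → ℝ)
    (hw : ∀ i ∈ s, lo i < w i ∧ w i < hi i) (hv : ∀ i ∈ s, v i ≠ 0) :
    ∃ t > 0, (∀ i ∈ s, w i + t * v i ∈ Set.Icc (lo i) (hi i)) ∧
      ∃ i ∈ s, w i + t * v i = lo i ∨ w i + t * v i = hi i := by
  let τ : ι → ℝ := fun i => if 0 < v i then (hi i - w i) / v i else (lo i - w i) / v i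
  obtain ⟨i₀, hi₀, hmin⟩ := Finset.exists_min_image s τ hs
  have hτ : ∀ i ∈ s, 0 < τ i := by
    intro i his
    obtain ⟨h1, h2⟩ := hw i his
    simp only [τ]
    split_ifs with h
    · exact div_pos (by linarith) h
    · exact div_pos_of_neg_of_neg (by linarith) (lt_of_le_of_ne (not_lt.1 h) (hv i his))
  refine ⟨τ i₀, hτ i₀ hi₀, fun i his => ?_, i₀, hi₀, ?_⟩
  · obtain ⟨h1, h2⟩ := hw i his
    have h0 := hτ i₀ hi₀
    have hm := hmin i his
    by_cases h : 0 < v i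
    · have e : τ i * v i = hi i - w i := by
        simp only [τ, if_pos h]
        exact div_mul_cancel₀ _ h.ne'
      have := mul_le_mul_of_nonneg_right hm h.le
      have := mul_pos h0 h
      constructor <;> linarith
    · have h' : v i < 0 := lt_of_le_of_ne (not_lt.1 h) (hv i his)
      have e : τ i * v i = lo i - w i := by
        simp only [τ, if_neg h]
        exact div_mul_cancel₀ _ h'.ne
      have := mul_le_mul_of_nonpos_right hm h'.le
      have := mul_neg_of_pos_of_neg h0 h'
      constructor <;> linarith
  · by_cases h : 0 < v i₀
    · right
      simp only [τ, if_pos h]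
      rw [div_mul_cancel₀ _ h.ne']
      ring
    · left
      simp only [τ, if_neg h]
      rw [div_mul_cancel₀ _ (hv i₀ hi₀)]
      ring

/-- Spreading two components of `x` apart decreases the product. -/
theorem exists_spread (ha : 0 ≤ a) (hc : 0 ≤ c) (hβ : 0 < β)
    {p : (Fin n → ℝ) × (Fin m → ℝ)} (hp : p ∈ monoSet n m a b c d α β)
    (hN : 1 < (interiorSet a b p.1).card) :
    ∃ z : Fin n → ℝ, (z, p.2) ∈ monoSet n m a b c d α β ∧
      (interiorSet a b z).card < (interiorSet a b p.1).card ∧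
      ∃ (σ : Equiv.Perm (Fin n)) (l r : ℝ), 0 ≤ l ∧ 0 ≤ r ∧ l + r = 1 ∧
        p = l • (z, p.2) + r • (z ∘ σ, p.2) := by
  obtain ⟨x, y⟩ := p
  dsimp only at *
  obtain ⟨i, hi, j, hj, hij, hle⟩ : ∃ i ∈ interiorSet a b x, ∃ j ∈ interiorSet a b x,
      i ≠ j ∧ x j ≤ x i := by
    obtain ⟨i, hi, j, hj, hij⟩ := Finset.one_lt_card.1 hN
    rcases le_total (x j) (x i) with h | h
    · exact ⟨i, hi, j, hj, hij, h⟩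
    · exact ⟨j, hj, i, hi, hij.symm, h⟩
  have hi' := mem_interiorSet.1 hi
  have hj' := mem_interiorSet.1 hj
  -- The largest admissible spread, so that one of the two components reaches its bound.
  set t := min (b - x i) (x j - a) with ht
  have ht1 : t ≤ b - x i := min_le_left _ _
  have ht2 : t ≤ x j - a := min_le_right _ _
  have ht0 : 0 < t := lt_min (by linarith [hi'.2]) (by linarith [hj'.1])
  set z : Fin n → ℝ := Function.update (Function.update x i (x i + t)) j (x j - t) with hz
  have hzj : z j = x j - t := by simp [hz]
  have hzi : z i = x i + t := by simp [hz, hij]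
  have hzo : ∀ s, s ≠ i → s ≠ j → z s = x s := fun s h1 h2 => by simp [hz, h1, h2]
  have hcases : ∀ s, s = i ∨ s = j ∨ (s ≠ i ∧ s ≠ j) := fun s => by tauto
  rw [mem_monoSet_iff ha hc hβ] at hp
  refine ⟨z, ?_, ?_, Equiv.swap i j, ?_⟩
  · rw [mem_monoSet_iff ha hc hβ]
    refine ⟨⟨fun s => ?_, hp.1.2⟩, le_trans ?_ hp.2⟩
    · rcases hcases s with rfl | rfl | ⟨h1, h2⟩
      · simp only [hzi]
        constructor <;> linarith
      · simp only [hzj]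
        constructor <;> linarith
      · simp only [hzo s h1 h2]
        exact hp.1.1 s
    · dsimp only
      have hsplit : ∀ v : Fin n → ℝ, ∏ s, v s = v i * v j * ∏ s ∈ {i, j}ᶜ, v s := fun v => by
        rw [← Finset.prod_pair hij, Finset.prod_mul_prod_compl]
      rw [hsplit, hsplit x, hzi, hzj, Finset.prod_congr rfl (g := x) fun s hs => ?_]
      · refine mul_le_mul_of_nonneg_right ?_
          (Finset.prod_nonneg fun s _ => ha.trans (hp.1.1 s).1)
        nlinarith
      · simp only [Finset.mem_compl, Finset.mem_insert, Finset.mem_singleton, not_or] at hs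
        exact hzo s hs.1 hs.2
  · refine Finset.card_lt_card (Finset.ssubset_iff_subset_ne.2 ⟨fun s hs => ?_, fun h => ?_⟩)
    · rcases hcases s with rfl | rfl | ⟨h1, h2⟩
      · exact hi
      · exact hj
      · rw [mem_interiorSet, ← hzo s h1 h2]
        exact mem_interiorSet.1 hs
    · rw [← h] at hi hj
      rw [mem_interiorSet] at hi hj
      rcases min_choice (b - x i) (x j - a) with h' | h'
      · linarith [hi.2]
      · linarith [hj.1]
  · have hden : 0 < x i - x j + 2 * t := by linarith
    -- These weights recover `x i` from `x i + t` and `x j - t`; swapping the two entries recovers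
    -- `x j`.
    refine ⟨(x i - x j + t) / (x i - x j + 2 * t), t / (x i - x j + 2 * t),
      div_nonneg (by linarith) hden.le, div_nonneg ht0.le hden.le, ?_, ?_⟩
    · rw [← add_div]
      exact (div_eq_one_iff_eq hden.ne').2 (by ring)
    · have hlr : (x i - x j + t) / (x i - x j + 2 * t) + t / (x i - x j + 2 * t) = 1 := by
        rw [← add_div]
        exact (div_eq_one_iff_eq hden.ne').2 (by ring)
      have hl := div_mul_cancel₀ (x i - x j + t) hden.ne'
      have hr := div_mul_cancel₀ t hden.ne'
      refine Prod.ext (funext fun s => ?_) ?_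
      · rcases hcases s with rfl | rfl | ⟨h1, h2⟩
        · simp only [Prod.fst_add, Prod.smul_fst, Pi.add_apply, Pi.smul_apply, smul_eq_mul,
            Function.comp, Equiv.swap_apply_left, hzi, hzj]
          linear_combination -hl - (x j - t) * hlr
        · simp only [Prod.fst_add, Prod.smul_fst, Pi.add_apply, Pi.smul_apply, smul_eq_mul,
            Function.comp, Equiv.swap_apply_right, hzi, hzj]
          linear_combination -hr - (x s - t) * hlr
        · simp only [Prod.fst_add, Prod.smul_fst, Pi.add_apply, Pi.smul_apply, smul_eq_mul,
            Function.comp, Equiv.swap_apply_of_ne_of_ne h1 h2, hzo s h1 h2]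
          rw [← add_mul, hlr, one_mul]
      · simp only [Prod.snd_add, Prod.smul_snd]
        rw [← add_smul, hlr, one_smul]

/-- The point on the line obtained by scaling the components `yᵢ`, `i ∈ I`, and `xⱼ`. -/
def scaledPoint (p : (Fin n → ℝ) × (Fin m → ℝ)) (j : Fin n) (I : Finset (Fin m)) (q t : ℝ) :
    (Fin n → ℝ) × (Fin m → ℝ) :=
  (fun s => if s = j then p.1 s + t * (q * p.1 s) else p.1 s,
    fun i => if i ∈ I then p.2 i + t * p.2 i else p.2 i)

/-- Bernoulli's inequality keeps the line of scaled points in the monomial set. -/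
theorem scaledPoint_mem_monoSet (ha : 0 ≤ a) (hc : 0 ≤ c) (hβ : 0 < β)
    {p : (Fin n → ℝ) × (Fin m → ℝ)} (hp : p ∈ monoSet n m a b c d α β)
    (j : Fin n) {I : Finset (Fin m)} (hI : ∀ i ∈ I, c < p.2 i) (hcard : β < I.card * α) {t : ℝ}
    (hbox : scaledPoint p j I (I.card * α / β) t ∈ box n m a b c d) :
    scaledPoint p j I (I.card * α / β) t ∈ monoSet n m a b c d α β := by
  rw [mem_monoSet_iff ha hc hβ] at *
  refine ⟨hbox, ?_⟩
  have hq : 1 ≤ I.card * α / β := (one_le_div hβ).2 hcard.le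
  have hne : I.Nonempty := by
    rw [Finset.nonempty_iff_ne_empty]
    rintro rfl
    simp at hcard
    linarith
  obtain ⟨i₀, hi₀⟩ := hne
  -- Bernoulli needs a nonnegative base: a scaled `p.2 i₀ > c ≥ 0` stays in `[c, d]`, so its factor
  -- cannot be negative.
  have ht : 0 ≤ 1 + t := by
    have h1 := (hbox.2 i₀).1
    simp only [scaledPoint, if_pos hi₀] at h1
    by_contra h
    have := mul_neg_of_neg_of_pos (not_le.1 h) (hc.trans_lt (hI i₀ hi₀))
    linarith
  have hY0 : 0 ≤ ∏ i, p.2 i := Finset.prod_nonneg fun i _ => hc.trans (hp.1.2 i).1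
  have hX0 : 0 ≤ ∏ i, p.1 i := Finset.prod_nonneg fun i _ => ha.trans (hp.1.1 i).1
  have hX : ∏ s, (scaledPoint p j I (I.card * α / β) t).1 s =
      (1 + I.card * α / β * t) * ∏ s, p.1 s := by
    rw [← Finset.mul_prod_erase _ _ (Finset.mem_univ j),
      ← Finset.mul_prod_erase _ p.1 (Finset.mem_univ j)]
    have : ∏ s ∈ Finset.univ.erase j, (scaledPoint p j I (I.card * α / β) t).1 s =
        ∏ s ∈ Finset.univ.erase j, p.1 s :=
      Finset.prod_congr rfl fun s hs => by simp [scaledPoint, Finset.ne_of_mem_erase hs]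
    rw [this]
    simp only [scaledPoint, if_true]
    ring
  have hY : ∏ i, (scaledPoint p j I (I.card * α / β) t).2 i =
      (1 + t) ^ I.card * ∏ i, p.2 i := by
    rw [← Finset.prod_mul_prod_compl I, ← Finset.prod_mul_prod_compl I p.2, ← mul_assoc,
      ← Finset.prod_const, ← Finset.prod_mul_distrib]
    congr 1
    · exact Finset.prod_congr rfl fun i hi => by simp only [scaledPoint, if_pos hi]; ring
    · exact Finset.prod_congr rfl fun i hi => by
        simp only [scaledPoint, if_neg (Finset.mem_compl.1 hi)]
  rw [hX, hY, Real.mul_rpow (pow_nonneg ht _) hY0, ← Real.rpow_natCast, ← Real.rpow_mul ht,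
    ← mul_div_assoc]
  exact mul_le_mul (one_add_mul_self_le_rpow_one_add (by linarith) hq) hp.2 hX0
    (Real.rpow_nonneg ht _)

/-- The sign of `ε` chooses the direction. Stopping at the first bound met makes one interior
component extremal and creates no new interior ones. -/
theorem exists_scaledPoint (ha : 0 ≤ a) (hc : 0 ≤ c) (hβ : 0 < β)
    {p : (Fin n → ℝ) × (Fin m → ℝ)} (hp : p ∈ monoSet n m a b c d α β)
    {j : Fin n} (hj : j ∈ interiorSet a b p.1) (hcard : β < (interiorSet c d p.2).card * α)
    {ε : ℝ} (hε : ε ≠ 0) :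
    ∃ t > 0, scaledPoint p j (interiorSet c d p.2) ((interiorSet c d p.2).card * α / β) (t * ε) ∈
        monoSet n m a b c d α β ∧
      (interiorSet a b (scaledPoint p j (interiorSet c d p.2)
        ((interiorSet c d p.2).card * α / β) (t * ε)).1).card +
      (interiorSet c d (scaledPoint p j (interiorSet c d p.2)
        ((interiorSet c d p.2).card * α / β) (t * ε)).2).card <
      (interiorSet a b p.1).card + (interiorSet c d p.2).card := by
  set I := interiorSet c d p.2 with hI
  set q : ℝ := I.card * α / β with hq
  have hq0 : 0 < q := div_pos (hβ.trans hcard) hβ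
  have hIc : ∀ i ∈ I, c < p.2 i ∧ p.2 i < d := fun i hi => mem_interiorSet.1 hi
  have hjx := mem_interiorSet.1 hj
  -- The index `none` stands for the moving `x` component. All speeds are nonzero because interior
  -- components are positive.
  obtain ⟨t, ht, hin, hex⟩ := exists_first_exit (Finset.insertNone I) ⟨none, by simp⟩
    (fun o => o.elim a fun _ => c) (fun o => o.elim b fun _ => d) (fun o => o.elim (p.1 j) p.2)
    (fun o => o.elim (ε * (q * p.1 j)) fun i => ε * p.2 i)
    (by
      rintro (_ | i) hi
      · exact hjx
      · exact hIc i (Finset.some_mem_insertNone.1 hi))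
    (by
      rintro (_ | i) hi
      · exact mul_ne_zero hε (mul_pos hq0 (ha.trans_lt hjx.1)).ne'
      · exact mul_ne_zero hε (hc.trans_lt (hIc i (Finset.some_mem_insertNone.1 hi)).1).ne')
  have hxj : (scaledPoint p j I q (t * ε)).1 j = p.1 j + t * (ε * (q * p.1 j)) := by
    simp [scaledPoint, mul_assoc]
  have hxo : ∀ s, s ≠ j → (scaledPoint p j I q (t * ε)).1 s = p.1 s := fun s hs => by
    simp [scaledPoint, hs]
  have hyI : ∀ i ∈ I, (scaledPoint p j I q (t * ε)).2 i = p.2 i + t * (ε * p.2 i) :=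
    fun i hi => by simp [scaledPoint, hi, mul_assoc]
  have hyo : ∀ i ∉ I, (scaledPoint p j I q (t * ε)).2 i = p.2 i := fun i hi => by
    simp [scaledPoint, hi]
  have hbox : scaledPoint p j I q (t * ε) ∈ box n m a b c d := by
    refine ⟨fun s => ?_, fun i => ?_⟩
    · by_cases hs : s = j
      · rw [hs, hxj]
        exact hin none (by simp)
      · rw [hxo s hs]
        exact hp.1.1 s
    · by_cases hi : i ∈ I
      · rw [hyI i hi]
        exact hin (some i) (by simpa using hi)
      · rw [hyo i hi]
        exact hp.1.2 i
  refine ⟨t, ht, scaledPoint_mem_monoSet ha hc hβ hp j (fun i hi => (hIc i hi).1) hcard hbox, ?_⟩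
  have hsub1 : interiorSet a b (scaledPoint p j I q (t * ε)).1 ⊆ interiorSet a b p.1 := by
    intro s hs
    by_cases hsj : s = j
    · rwa [hsj]
    · rw [mem_interiorSet, ← hxo s hsj]
      exact mem_interiorSet.1 hs
  have hsub2 : interiorSet c d (scaledPoint p j I q (t * ε)).2 ⊆ I := by
    intro i hi
    by_contra hiI
    refine hiI (mem_interiorSet.2 ?_)
    rw [← hyo i hiI]
    exact mem_interiorSet.1 hi
  obtain ⟨_ | i, hi, hex⟩ := hex
  · refine add_lt_add_of_lt_of_le (Finset.card_lt_card
      (Finset.ssubset_iff_subset_ne.2 ⟨hsub1, fun h => ?_⟩)) (Finset.card_le_card hsub2)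
    have h' := mem_interiorSet.1 (h.symm ▸ hj)
    rw [hxj] at h'
    rcases hex with hex | hex
    · exact h'.1.ne' hex
    · exact h'.2.ne hex
  · have hi : i ∈ I := by simpa using hi
    refine add_lt_add_of_le_of_lt (Finset.card_le_card hsub1) (Finset.card_lt_card
      (Finset.ssubset_iff_subset_ne.2 ⟨hsub2, fun h => ?_⟩))
    have h' := mem_interiorSet.1 (h.symm ▸ hi)
    rw [hyI i hi] at h'
    rcases hex with hex | hex
    · exact h'.1.ne' hex
    · exact h'.2.ne hex

theorem lt_mul_of_freeCount_lt (hα : 0 < α) {k : ℕ} (hkm : k ≤ m)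
    (hk : freeCount m α β < k) : β < k * α := by
  have h : ⌊β / α⌋₊ < k := by
    rcases min_lt_iff.1 hk with h | h
    · omega
    · exact h
  exact (div_lt_iff₀ hα).1 (Nat.lt_of_floor_lt h)

theorem monoSet_subset_of_pieceUnion_subset (ha : 0 ≤ a) (hc : 0 ≤ c) (hα : 0 < α) (hβ : 0 < β)
    {K : Set ((Fin n → ℝ) × (Fin m → ℝ))} (hconv : Convex ℝ K) (hperm : PermInvariant K)
    (hT : pieceUnion n m a b c d α β ⊆ K) : monoSet n m a b c d α β ⊆ K := by
  intro p hp
  induction hk : (interiorSet a b p.1).card + (interiorSet c d p.2).card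
    using Nat.strong_induction_on generalizing p with
  | _ k ih =>
  subst hk
  by_cases hN : 1 < (interiorSet a b p.1).card
  · obtain ⟨z, hz, hlt, σ, l, r, hl, hr, hlr, hpz⟩ := exists_spread ha hc hβ hp hN
    have hzK : (z, p.2) ∈ K := ih _ (Nat.add_lt_add_right hlt _) hz rfl
    rw [hpz]
    exact hconv hzK (hperm _ hzK σ 1) hl hr hlr
  by_cases hM : (interiorSet a b p.1).card = 1 ∧ freeCount m α β < (interiorSet c d p.2).card
  · obtain ⟨j, hj⟩ := Finset.card_pos.1 (hM.1.symm ▸ one_pos)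
    have hcard := lt_mul_of_freeCount_lt (β := β) hα
      (by simpa using Finset.card_le_univ (interiorSet c d p.2)) hM.2
    obtain ⟨t, ht, htS, htlt⟩ := exists_scaledPoint ha hc hβ hp hj hcard one_ne_zero
    obtain ⟨s, hs, hsS, hslt⟩ := exists_scaledPoint ha hc hβ hp hj hcard
      (neg_ne_zero.2 one_ne_zero)
    -- The displacements are `t` and `-s`, so these weights return to `p`.
    have h := hconv (ih _ htlt htS rfl) (ih _ hslt hsS rfl)
      (a := s / (s + t)) (b := t / (s + t)) (by positivity) (by positivity) (by field_simp)
    convert h using 1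
    refine Prod.ext (funext fun i => ?_) (funext fun i => ?_)
    · simp only [scaledPoint, Prod.fst_add, Prod.smul_fst, Pi.add_apply, Pi.smul_apply,
        smul_eq_mul]
      split_ifs
      · field_simp
        ring
      · field_simp
    · simp only [scaledPoint, Prod.snd_add, Prod.smul_snd, Pi.add_apply, Pi.smul_apply,
        smul_eq_mul]
      split_ifs
      · field_simp
        ring
      · field_simp
  -- What remains is no interior x, or exactly one with at most k interior y's: after sorting, a
  -- point of some C_j or S_ij.
  · obtain ⟨σ, hσ⟩ := exists_sortedDesc_eq_comp p.1
    obtain ⟨τ, hτ⟩ := exists_sortedDesc_eq_comp p.2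
    have hmem : (p.1 ∘ σ, p.2 ∘ τ) ∈ pieceUnion n m a b c d α β := by
      refine mem_pieceUnion_of_antitone (permInvariant_monoSet p hp σ τ)
        (hσ ▸ antitone_sortedDesc p.1) (hτ ▸ antitone_sortedDesc p.2) ?_
      simp only [card_interiorSet_comp]
      omega
    have h := hperm _ (hT hmem) σ.symm τ.symm
    simpa [Function.comp_assoc] using h

theorem convexHull_monoSet_eq_liftedHull (ha : 0 ≤ a) (hc : 0 ≤ c) (hα : 0 < α) (hβ : 0 < β) :
    convexHull ℝ (monoSet n m a b c d α β) = liftedHull n m a b c d α β :=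
  (convexHull_min (monoSet_subset_of_pieceUnion_subset ha hc hα hβ convex_liftedHull
    permInvariant_liftedHull pieceUnion_subset_liftedHull) convex_liftedHull).antisymm
    liftedHull_subset_convexHull

/-! ### The vector `u^s` and the description without lifting -/

/-- The `i`-th affine piece of the product of the components of `u^s`. -/
def stepLine (n : ℕ) (a b : ℝ) (i : ℕ) (s : ℝ) : ℝ :=
  b ^ i * a ^ (n - 1 - i) * (a + s - (b - a) * i)

/-- Remove one factor `x e` and let A be the bracket formed from the others. If A ≤ a, drop a factor
`b`, with error a multiple of (b - x e)(a - A); if A ≥ a, drop a factor `a`, with error a multiple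
of (x e - a)(A - a). When the factor to drop is absent, A equals a or the other entries sum to their
maximum, and the other kind is dropped. -/
theorem affine_le_prod {ι : Type*} (ha : 0 ≤ a) (hab : a ≤ b) (x : ι → ℝ) (s : Finset ι)
    (hx : ∀ j ∈ s, x j ∈ Set.Icc a b) (i k : ℕ) (hik : s.card = i + k + 1) :
    b ^ i * a ^ k * (a + ∑ j ∈ s, (x j - a) - (b - a) * i) ≤ ∏ j ∈ s, x j := by
  classical
  induction s using Finset.induction_on generalizing i k with
  | empty => simp at hik
  | insert e s he ih =>
    have hb : 0 ≤ b := ha.trans hab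
    rw [Finset.card_insert_of_notMem he] at hik
    rw [Finset.prod_insert he, Finset.sum_insert he]
    have hs : ∀ j ∈ s, x j ∈ Set.Icc a b := fun j hj => hx j (Finset.mem_insert_of_mem hj)
    obtain ⟨h1, h2⟩ := hx e (Finset.mem_insert_self _ _)
    have hlow : 0 ≤ ∑ j ∈ s, (x j - a) := Finset.sum_nonneg fun j hj => by linarith [(hs j hj).1]
    have hupp : ∑ j ∈ s, (x j - a) ≤ (b - a) * s.card := by
      rw [mul_comm, ← nsmul_eq_mul]
      exact Finset.sum_le_card_nsmul _ _ _ fun j hj => by linarith [(hs j hj).2]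
    rcases le_total (a + ∑ j ∈ s, (x j - a) - (b - a) * i) a with hA | hA
    · rcases i with _ | i
      · rcases k with _ | k
        · have : s = ∅ := by
            rw [← Finset.card_eq_zero]
            omega
          subst this
          simp
        · have h0 : ∑ j ∈ s, (x j - a) = 0 := by
            push_cast at hA
            linarith
          have h := mul_le_mul_of_nonneg_left (ih hs 0 k (by omega)) (ha.trans h1)
          refine le_trans (le_of_eq ?_) h
          rw [h0]
          push_cast
          ring
      · have h := mul_le_mul_of_nonneg_left (ih hs i k (by omega)) (ha.trans h1)
        refine le_trans ?_ h
        push_cast at hA ⊢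
        have hP : 0 ≤ b ^ i * a ^ k := by positivity
        have key : 0 ≤ (b - x e) * (b - (a + ∑ j ∈ s, (x j - a) - (b - a) * i)) :=
          mul_nonneg (by linarith) (by linarith)
        have := mul_nonneg hP key
        rw [pow_succ]
        linarith
    · rcases k with _ | k
      · have hcard : (s.card : ℝ) = i := by
          norm_cast
          omega
        rw [hcard] at hupp
        have h0 : ∑ j ∈ s, (x j - a) = (b - a) * i := by linarith
        rcases i with _ | i
        · have : s = ∅ := by
            rw [← Finset.card_eq_zero]
            omega
          subst this
          simp
        · have h := mul_le_mul_of_nonneg_left (ih hs i 0 (by omega)) (ha.trans h1)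
          refine le_trans (le_of_eq ?_) h
          rw [h0]
          push_cast
          ring
      · have h := mul_le_mul_of_nonneg_left (ih hs i k (by omega)) (ha.trans h1)
        refine le_trans ?_ h
        have hP : 0 ≤ b ^ i * a ^ k := by positivity
        have key : 0 ≤ (x e - a) * ((a + ∑ j ∈ s, (x j - a) - (b - a) * i) - a) :=
          mul_nonneg (by linarith) (by linarith)
        have := mul_nonneg hP key
        rw [pow_succ]
        linarith

theorem stepLine_le_prod (ha : 0 ≤ a) (hab : a ≤ b) {x : Fin n → ℝ}
    (hx : ∀ j, x j ∈ Set.Icc a b) {i : ℕ} (hi : i < n) :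
    stepLine n a b i (∑ j, (x j - a)) ≤ ∏ j, x j :=
  affine_le_prod ha hab x Finset.univ (fun j _ => hx j) i (n - 1 - i)
    (by rw [Finset.card_univ, Fintype.card_fin]; omega)

/-- The shape of `u^s`. -/
theorem exists_stepVec_shape (hn : 1 ≤ n) (hab : a ≤ b) {s : ℝ} (hs0 : 0 ≤ s)
    (hs1 : s ≤ n * (b - a)) :
    ∃ i : ℕ, i < n ∧ 0 ≤ s - (b - a) * i ∧ s - (b - a) * i ≤ b - a ∧
      ∀ r : Fin n, stepVec n a b s r =
        if r.val < i then b else if r.val = i then a + s - (b - a) * i else a := by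
  rcases hab.eq_or_lt with rfl | hab
  · have hs : s = 0 := by
      simp at hs1
      linarith
    subst hs
    refine ⟨0, hn, by simp, by simp, fun r => ?_⟩
    simp only [stepVec]
    split_ifs <;> simp
  have hba : 0 < b - a := by linarith
  have hset : {i : ℤ | (i : ℝ) * (b - a) < s} = Set.Iic (⌈s / (b - a)⌉ - 1) := by
    ext i
    rw [Set.mem_ofPred_eq, Set.mem_Iic, ← lt_div_iff₀ hba, ← Int.lt_ceil]
    omega
  have hidx : stepIndex a b s = ⌈s / (b - a)⌉ - 1 := by
    rw [stepIndex, hset, csSup_Iic]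
  -- At `s = 0` the index is -1, so no entry is `b` or intermediate; the shape with `i = 0` still
  -- fits, its middle value being `a`.
  rcases hs0.eq_or_lt with rfl | hs0
  · refine ⟨0, hn, by simp, by simpa using hba.le, fun r => ?_⟩
    rw [stepVec, hidx]
    simp only [zero_div, Int.ceil_zero]
    rw [if_neg (by omega), if_neg (by omega)]
    split_ifs <;> first | omega | simp
  have hpos : 0 < ⌈s / (b - a)⌉ := Int.ceil_pos.2 (div_pos hs0 hba)
  have hle : ⌈s / (b - a)⌉ ≤ n := Int.ceil_le.2 (by
    rw [div_le_iff₀ hba]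
    exact_mod_cast hs1)
  obtain ⟨i, hi⟩ := Int.eq_ofNat_of_zero_le (a := ⌈s / (b - a)⌉ - 1) (by omega)
  have hc1 : (⌈s / (b - a)⌉ : ℝ) = i + 1 := by
    have : ⌈s / (b - a)⌉ = (i : ℤ) + 1 := by omega
    rw [this]
    push_cast
    rfl
  have h1 := Int.le_ceil (s / (b - a))
  have h2 := Int.ceil_lt_add_one (s / (b - a))
  rw [hc1] at h1 h2
  rw [div_le_iff₀ hba] at h1
  have h2' : (i : ℝ) < s / (b - a) := by linarith
  rw [lt_div_iff₀ hba] at h2'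
  refine ⟨i, by omega, by linarith, by linarith, fun r => ?_⟩
  rw [stepVec, hidx, hi]
  push_cast
  congr 1
  · rw [eq_iff_iff]
    omega
  · congr 1
    rw [eq_iff_iff]
    omega

theorem sum_sub_mem {x : Fin n → ℝ} (hx : ∀ j, x j ∈ Set.Icc a b) :
    0 ≤ ∑ j, (x j - a) ∧ ∑ j, (x j - a) ≤ n * (b - a) := by
  constructor
  · exact Finset.sum_nonneg fun j _ => by linarith [(hx j).1]
  · have := Finset.sum_le_card_nsmul Finset.univ (fun j => x j - a) (b - a)
      fun j _ => by linarith [(hx j).2]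
    simpa using this

theorem sum_shape {i : ℕ} (hi : i < n) (t : ℝ) :
    ∑ r : Fin n, (if r.val < i then b else if r.val = i then t else a) =
      b * i + t + a * (n - 1 - i) := by
  obtain ⟨k, rfl⟩ := Nat.exists_eq_add_of_lt hi
  rw [Fin.sum_univ_eq_sum_range (fun r => if r < i then b else if r = i then t else a),
    add_assoc, Finset.sum_range_add, Finset.sum_range_succ',
    Finset.sum_congr (s₁ := Finset.range i) (g := fun _ => b) rfl
      fun r hr => if_pos (Finset.mem_range.1 hr),
    Finset.sum_congr (s₁ := Finset.range k) (g := fun _ => a) rfl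
      fun r _ => by rw [if_neg (by omega), if_neg (by omega)]]
  simp
  ring

theorem prod_shape {i : ℕ} (hi : i < n) (t : ℝ) :
    ∏ r : Fin n, (if r.val < i then b else if r.val = i then t else a) =
      b ^ i * a ^ (n - 1 - i) * t := by
  obtain ⟨k, rfl⟩ := Nat.exists_eq_add_of_lt hi
  rw [Fin.prod_univ_eq_prod_range (fun r => if r < i then b else if r = i then t else a),
    add_assoc, Finset.prod_range_add, Finset.prod_range_succ',
    Finset.prod_congr (s₁ := Finset.range i) (g := fun _ => b) rfl
      fun r hr => if_pos (Finset.mem_range.1 hr),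
    Finset.prod_congr (s₁ := Finset.range k) (g := fun _ => a) rfl
      fun r _ => by rw [if_neg (by omega), if_neg (by omega)]]
  simp
  ring

theorem majVec_mem_Icc (hn : 1 ≤ n) {x : Fin n → ℝ} (hx : ∀ j, x j ∈ Set.Icc a b) (r : Fin n) :
    majVec a b x r ∈ Set.Icc a b := by
  have hab : a ≤ b := (hx r).1.trans (hx r).2
  obtain ⟨i, hi, h1, h2, h⟩ := exists_stepVec_shape hn hab (sum_sub_mem hx).1 (sum_sub_mem hx).2
  rw [majVec, h]
  split_ifs <;> constructor <;> linarith

theorem exists_prod_majVec_eq (hn : 1 ≤ n) {x : Fin n → ℝ} (hx : ∀ j, x j ∈ Set.Icc a b) :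
    ∃ i < n, ∏ r, majVec a b x r = stepLine n a b i (∑ j, (x j - a)) := by
  have hab : a ≤ b := (hx ⟨0, hn⟩).1.trans (hx ⟨0, hn⟩).2
  obtain ⟨i, hi, h1, h2, h⟩ := exists_stepVec_shape hn hab (sum_sub_mem hx).1 (sum_sub_mem hx).2
  refine ⟨i, hi, ?_⟩
  simp only [majVec, h]
  exact prod_shape hi _

theorem sum_majVec (hn : 1 ≤ n) {x : Fin n → ℝ} (hx : ∀ j, x j ∈ Set.Icc a b) :
    ∑ r, majVec a b x r = ∑ r, x r := by
  have hab : a ≤ b := (hx ⟨0, hn⟩).1.trans (hx ⟨0, hn⟩).2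
  obtain ⟨i, hi, h1, h2, h⟩ := exists_stepVec_shape hn hab (sum_sub_mem hx).1 (sum_sub_mem hx).2
  simp only [majVec, h]
  rw [sum_shape hi, Finset.sum_sub_distrib]
  simp
  ring

/-- The general bound is applied to `u(x)` itself, whose sum is that of `x`. With
`exists_prod_majVec_eq` this makes the product of `u(x)` the maximum of the affine pieces. -/
theorem stepLine_le_prod_majVec (hn : 1 ≤ n) (ha : 0 ≤ a) {x : Fin n → ℝ}
    (hx : ∀ j, x j ∈ Set.Icc a b) {i : ℕ} (hi : i < n) :
    stepLine n a b i (∑ j, (x j - a)) ≤ ∏ j, majVec a b x j := by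
  have hab : a ≤ b := (hx ⟨0, hn⟩).1.trans (hx ⟨0, hn⟩).2
  have h := stepLine_le_prod ha hab (majVec_mem_Icc hn hx) hi
  rwa [Finset.sum_sub_distrib, sum_majVec hn hx, ← Finset.sum_sub_distrib] at h

/-- Up to the intermediate entry the prefixes consist of `b`'s, hence are maximal; beyond it the
tails consist of `a`'s, hence are minimal, and the totals agree. -/
theorem majorizes_majVec (hn : 1 ≤ n) {x : Fin n → ℝ} (hx : ∀ j, x j ∈ Set.Icc a b) :
    Majorizes (majVec a b x) x := by
  have hab : a ≤ b := (hx ⟨0, hn⟩).1.trans (hx ⟨0, hn⟩).2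
  obtain ⟨i, hi, h1, h2, h⟩ := exists_stepVec_shape hn hab (sum_sub_mem hx).1 (sum_sub_mem hx).2
  have hanti : Antitone (majVec a b x) := by
    intro r t hrt
    have hrt' : r.val ≤ t.val := hrt
    simp only [majVec, h]
    split_ifs <;> first | omega | linarith
  refine ⟨fun j _ hj => ?_, by rw [sum_sortedDesc, sum_sortedDesc, sum_majVec hn hx]⟩
  rw [sortedDesc_of_antitone hanti]
  obtain ⟨σ, hσ⟩ := exists_sortedDesc_eq_comp x
  have hσx : ∀ r, sortedDesc x r ∈ Set.Icc a b := fun r => hσ ▸ hx (σ r)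
  rcases le_or_gt j i with hji | hji
  · refine Finset.sum_le_sum fun r hr => ?_
    have hr' : r.val < j := (Finset.mem_filter.1 hr).2
    rw [majVec, h, if_pos (by omega)]
    exact (hσx r).2
  · have e1 := Finset.sum_filter_add_sum_filter_not Finset.univ (fun r : Fin n => r.val < j)
      (sortedDesc x)
    have e2 := Finset.sum_filter_add_sum_filter_not Finset.univ (fun r : Fin n => r.val < j)
      (majVec a b x)
    have e3 : ∑ r : Fin n with ¬ r.val < j, majVec a b x r ≤
        ∑ r : Fin n with ¬ r.val < j, sortedDesc x r := by
      refine Finset.sum_le_sum fun r hr => ?_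
      have hr' : ¬ r.val < j := (Finset.mem_filter.1 hr).2
      rw [majVec, h, if_neg (by omega), if_neg (by omega)]
      exact (hσx r).1
    rw [sum_sortedDesc] at e1
    rw [sum_majVec hn hx] at e2
    linarith

/-! ### Convexity of the unlifted set and its equality with the hull -/

theorem mem_unliftedHull_iff (hn : 1 ≤ n) (hm : 1 ≤ m) (ha : 0 ≤ a) (hc : 0 ≤ c) (hα : 0 < α)
    (hβ : 0 < β) {p : (Fin n → ℝ) × (Fin m → ℝ)} : p ∈ unliftedHull n m a b c d α β ↔
      p ∈ box n m a b c d ∧ ∏ j, majVec a b p.1 j ≤ (∏ i, p.2 i) ^ (α / β) := by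
  have hm0 : (0 : ℝ) < m := by exact_mod_cast hm
  refine and_congr_right fun hp => ?_
  rw [prod_rpow_le_prod_rpow_iff (fun j => ha.trans (majVec_mem_Icc hn hp.1 j).1)
    (fun i => hc.trans (hp.2 i).1) (by positivity)]
  have : 1 / (m : ℝ) / (β / (m * α)) = α / β := by field_simp
  rw [this]

theorem convex_unliftedHull (hn : 1 ≤ n) (hm : 1 ≤ m) (ha : 0 ≤ a) (hc : 0 ≤ c) (hα : 0 < α)
    (hβ : 0 < β) (hmα : m * α ≤ β) : Convex ℝ (unliftedHull n m a b c d α β) := by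
  intro p hp q hq l r hl hr hlr
  rw [mem_unliftedHull_iff hn hm ha hc hα hβ] at *
  have hbox := convex_box n m a b c d hp.1 hq.1 hl hr hlr
  refine ⟨hbox, ?_⟩
  -- Take the affine piece active at the combination; at both endpoints it lies below the product of
  -- `u`.
  obtain ⟨i, hi, he⟩ := exists_prod_majVec_eq hn hbox.1
  have hcon := (concaveOn_prod_rpow (Finset.univ : Finset (Fin m)) (div_pos hα hβ)
    (by rw [← mul_div_assoc]; exact (div_le_one hβ).2 (by simpa using hmα))).2
    (x := p.2) (fun i => hc.trans (hp.1.2 i).1) (y := q.2) (fun i => hc.trans (hq.1.2 i).1)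
    hl hr hlr
  have hsum : ∑ j, ((l • p + r • q).1 j - a) =
      l * ∑ j, (p.1 j - a) + r * ∑ j, (q.1 j - a) := by
    rw [Finset.mul_sum, Finset.mul_sum, ← Finset.sum_add_distrib]
    refine Finset.sum_congr rfl fun j _ => ?_
    simp only [Prod.fst_add, Prod.smul_fst, Pi.add_apply, Pi.smul_apply, smul_eq_mul]
    linear_combination a * hlr
  have hline : stepLine n a b i (∑ j, ((l • p + r • q).1 j - a)) =
      l * stepLine n a b i (∑ j, (p.1 j - a)) + r * stepLine n a b i (∑ j, (q.1 j - a)) := by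
    rw [hsum]
    simp only [stepLine]
    linear_combination (-(b ^ i * a ^ (n - 1 - i)) * (a - (b - a) * i)) * hlr
  rw [he, hline]
  refine le_trans ?_ hcon
  have h1 := (stepLine_le_prod_majVec hn ha hp.1.1 hi).trans hp.2
  have h2 := (stepLine_le_prod_majVec hn ha hq.1.1 hi).trans hq.2
  simp only [smul_eq_mul]
  gcongr

theorem monoSet_subset_unliftedHull (hn : 1 ≤ n) (hm : 1 ≤ m) (ha : 0 ≤ a) (hc : 0 ≤ c)
    (hα : 0 < α) (hβ : 0 < β) : monoSet n m a b c d α β ⊆ unliftedHull n m a b c d α β := by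
  intro p hp
  rw [mem_monoSet_iff ha hc hβ] at hp
  rw [mem_unliftedHull_iff hn hm ha hc hα hβ]
  refine ⟨hp.1, le_trans ?_ hp.2⟩
  obtain ⟨i, hi, he⟩ := exists_prod_majVec_eq hn hp.1.1
  rw [he]
  exact stepLine_le_prod ha ((hp.1.1 ⟨0, hn⟩).1.trans (hp.1.1 ⟨0, hn⟩).2) hp.1.1 hi

theorem unliftedHull_subset_convexHull (hn : 1 ≤ n) (hm : 1 ≤ m) (ha : 0 ≤ a) (hc : 0 ≤ c)
    (hα : 0 < α) (hβ : 0 < β) :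
    unliftedHull n m a b c d α β ⊆ convexHull ℝ (monoSet n m a b c d α β) := by
  intro p hp
  rw [mem_unliftedHull_iff hn hm ha hc hα hβ] at hp
  have h : (majVec a b p.1, p.2) ∈ monoSet n m a b c d α β :=
    (mem_monoSet_iff ha hc hβ).2 ⟨⟨majVec_mem_Icc hn hp.1.1, hp.1.2⟩, hp.2⟩
  exact permInvariant_monoSet.convexHull.mem_of_majorizes (convex_convexHull ℝ _)
    (subset_convexHull ℝ _ h) (majorizes_majVec hn hp.1.1) (.refl _)

theorem convexHull_monoSet_eq_unliftedHull (hn : 1 ≤ n) (hm : 1 ≤ m) (ha : 0 ≤ a) (hc : 0 ≤ c)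
    (hα : 0 < α) (hβ : 0 < β) (hmα : m * α ≤ β) :
    convexHull ℝ (monoSet n m a b c d α β) = unliftedHull n m a b c d α β :=
  (convexHull_min (monoSet_subset_unliftedHull hn hm ha hc hα hβ)
    (convex_unliftedHull hn hm ha hc hα hβ hmα)).antisymm
    (unliftedHull_subset_convexHull hn hm ha hc hα hβ)

end PermHull

theorem proposition11 (n m : ℕ) (hn : 1 ≤ n) (hm : 1 ≤ m) (a b c d α β : ℝ)
    (ha : 0 ≤ a) (hc : 0 ≤ c) (hα : 0 < α) (hβ : 0 < β) :
    (∀ i j : ℕ, i ≤ m - PermHull.freeCount m α β → j < n →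
      Convex ℝ (PermHull.pieceS n m a b c d α β i j)) ∧
    (∀ j : ℕ, j ≤ n → Convex ℝ (PermHull.pieceC n m a b c d α β j)) ∧
    convexHull ℝ (PermHull.monoSet n m a b c d α β) = PermHull.liftedHull n m a b c d α β ∧
    ((m : ℝ) * α ≤ β →
      convexHull ℝ (PermHull.monoSet n m a b c d α β) =
        PermHull.unliftedHull n m a b c d α β) :=
  ⟨fun _ _ _ hj => PermHull.convex_pieceS ha hc hα hβ hj,
    fun j _ => PermHull.convex_pieceC ha hc hα hm j,
    PermHull.convexHull_monoSet_eq_liftedHull ha hc hα hβ,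
    PermHull.convexHull_monoSet_eq_unliftedHull hn hm ha hc hα hβ⟩
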